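/- Let $n\ge 3$ and $1\le m\le n$. Let $T_n$ be the full transformation monoid, consisting of all maps from $\{1,\dots,n\}$ to itself under composition (maps written on the right, so $\alpha\beta$ means first $\alpha$, then $\beta$), and let $I_m=\{\alpha\in T_n : |\operatorname{im}\alpha|\le m\}$, an ideal of $T_n$ regarded as a semigroup in its own right. For a finite semigroup $S$ whose $\mathcal J$-classes form a chain $J_\epsilon<\dots<J_k$, let the depth of an element of $J_i$ be $k-i+1$, that is, the number of $\mathcal J$-classes $J$ with $J\ge J_i$. Given a semigroup presentation $\mathcal P=\langle A\mid R\rangle$ of $S$ (with $A$ a finite alphabet, $R\subseteq A^+\times A^+$, and a fixed isomorphism $A^+/R^\sharp\cong S$, where $R^\sharp$ is the congruence generated by $R$), the depth of a relation $(u=v)\in R$ is the depth of the element of $S$ represented by $u$ (equivalently by $v$), and the depth of $\mathcal P$ is the maximal depth of a relation in $R$. The relational depth $d(S)$ is the minimum of the depths of all presentations of $S$. Then $$d(I_m)=\begin{cases}3 & \text{if } m=n,\\ n-m+1 & \text{if } \frac{n+1}{2}<m<n,\\ m & \text{if } m\le\frac{n+1}{2}.\end{cases}$$ -/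

import Mathlib

/-! ### Green's `𝒥`-relation -/

/-- The principal two-sided ideal `S¹ x S¹` of a semigroup `S`, as a subset of `S`.
(Adjoining an identity to a semigroup that already has one does not change this set.) -/
def principalIdeal {S : Type*} [Semigroup S] (x : S) : Set S :=
  {z | ∃ a b : WithOne S, (z : WithOne S) = a * (x : WithOne S) * b}

/-- Green's relation `𝒥`: two elements are related if they generate the same principal ideal. -/
def greenJ (S : Type*) [Semigroup S] : Setoid S where
  r x y := principalIdeal x = principalIdeal y
  iseqv := ⟨fun _ => rfl, fun h => h.symm, fun h k => h.trans k⟩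

/-- The type of `𝒥`-classes of `S`. -/
abbrev JClass (S : Type*) [Semigroup S] : Type _ := Quotient (greenJ S)

/-- The natural partial order on `𝒥`-classes: `J_x ≤ J_y` iff `S¹ x S¹ ⊆ S¹ y S¹`. -/
instance JClass.instPartialOrder (S : Type*) [Semigroup S] : PartialOrder (JClass S) where
  le := Quotient.lift₂ (fun x y : S => principalIdeal x ⊆ principalIdeal y) (by
    intro a b c d hac hbd
    have h1 : principalIdeal a = principalIdeal c := hac
    have h2 : principalIdeal b = principalIdeal d := hbd
    simp only [h1, h2])
  le_refl := by
    intro a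
    induction a using Quotient.inductionOn with
    | h a => exact Set.Subset.refl (principalIdeal a)
  le_trans := by
    intro a b c
    induction a using Quotient.inductionOn with
    | h a =>
      induction b using Quotient.inductionOn with
      | h b =>
        induction c using Quotient.inductionOn with
        | h c => exact fun h k => Set.Subset.trans (b := principalIdeal b) h k
  le_antisymm := by
    intro a b
    induction a using Quotient.inductionOn with
    | h a =>
      induction b using Quotient.inductionOn with
      | h b => exact fun h k => Quotient.sound (Set.Subset.antisymm h k)

/-- The depth of a `𝒥`-class `J`: the number of `𝒥`-classes `K` with `J ≤ K`.
If the `𝒥`-classes form a finite chain `J_ε < ⋯ < J_k`, the depth of `J_i` is `k - i + 1`. -/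
noncomputable def JClass.depth {S : Type*} [Semigroup S] (J : JClass S) : ℕ∞ :=
  Set.encard {K : JClass S | J ≤ K}

/-- The depth of an element is the depth of its `𝒥`-class. -/
noncomputable def elementDepth {S : Type*} [Semigroup S] (s : S) : ℕ∞ :=
  JClass.depth (Quotient.mk (greenJ S) s)

/-! ### Semigroup presentations -/

/-- A semigroup presentation `⟨A | R⟩` of `S`, with a finite alphabet `A`: a set `R` of pairs of
words in `A⁺`, and an isomorphism from the quotient of `A⁺` by the congruence generated by `R`
to `S`. -/
structure SemigroupPresentation (S : Type*) [Semigroup S] where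
  /-- the alphabet -/
  Gen : Type
  finite_gen : Finite Gen
  /-- the defining relations -/
  rels : Set (FreeSemigroup Gen × FreeSemigroup Gen)
  /-- the semigroup defined by the presentation is `S` -/
  iso : (conGen fun u v => (u, v) ∈ rels).Quotient ≃* S

namespace SemigroupPresentation

variable {S : Type*} [Semigroup S] (P : SemigroupPresentation S)

/-- The element of `S` represented by a word. -/
def eval (w : FreeSemigroup P.Gen) : S :=
  P.iso (w : (conGen fun u v => (u, v) ∈ P.rels).Quotient)

/-- The depth of a word is the depth of the element that it represents. -/
noncomputable def wordDepth (w : FreeSemigroup P.Gen) : ℕ∞ :=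
  elementDepth (P.eval w)

/-- The depth of a presentation is the maximal depth of a defining relation `u = v`
(for which the depths of `u` and `v` coincide). -/
noncomputable def depth : ℕ∞ :=
  ⨆ r ∈ P.rels, P.wordDepth r.1

end SemigroupPresentation

/-- The relational depth of `S`: the least depth of a presentation of `S`. -/
noncomputable def relationalDepth (S : Type*) [Semigroup S] : ℕ∞ :=
  ⨅ P : SemigroupPresentation S, P.depth

/-! ### The full transformation monoid and its ideals -/

/-- The full transformation monoid `T_n` of all maps from an `n`-element set to itself, where
`α * β` means: first apply `α`, then apply `β`. -/
abbrev FullTransformation (n : ℕ) : Type := (Function.End (Fin n))ᵐᵒᵖ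

/-- The rank of a transformation is the size of its image. -/
noncomputable def FullTransformation.rank {n : ℕ} (α : FullTransformation n) : ℕ :=
  (Set.range (MulOpposite.unop α : Fin n → Fin n)).ncard

theorem FullTransformation.rank_mul_le_left {n : ℕ} (α β : FullTransformation n) :
    FullTransformation.rank (α * β) ≤ FullTransformation.rank α := by
  have h : Set.range (MulOpposite.unop (α * β) : Fin n → Fin n)
      = (MulOpposite.unop β : Fin n → Fin n) ''
        Set.range (MulOpposite.unop α : Fin n → Fin n) :=
    Set.range_comp (MulOpposite.unop β : Fin n → Fin n) (MulOpposite.unop α : Fin n → Fin n)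
  unfold FullTransformation.rank
  rw [h]
  exact Set.ncard_image_le (Set.toFinite _)

/-- The ideal `I_m` of `T_n` of all transformations of rank at most `m`, as a semigroup. -/
def rankIdeal (n m : ℕ) : Subsemigroup (FullTransformation n) where
  carrier := {α | FullTransformation.rank α ≤ m}
  mul_mem' := fun {α β} hα _ => (FullTransformation.rank_mul_le_left α β).trans hα

/-!
Transformations act on the right; in the ideal `I_m` of transformations of rank at most `m`,
the `𝒥`-classes are the sets of transformations of equal rank, so that depth `d` means rank
`m + 1 - d` (`elementDepth_eq`). The question is for which `r` the relations of rank at least `r`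
suffice to define `I_m`.

*Upper bounds.* Take all elements of rank at least `r` as generators and all valid relations of rank
at least `r`. Descending induction on `k < r` shows that words of rank `k` with equal values are
congruent. A word of rank `k` is congruent to a product of two words of larger rank, so the point is
that any two factorizations `p * q = p' * q'` of a transformation `σ` of rank `k` into factors of
larger rank are linked by moves `(p x) q = p (x q)` in which `p x` and `x q` keep rank above `k`
(`map_mul_map_eq`). The right factor hits some point `z` outside the image of `σ`; the basic move
(`map_mul_map_eq_refine`) refines the kernel of `p` and replaces the right factor by the one that
sends everything outside the image of the new left factor to `z`. It needs `rank p < m`. If `q` has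
rank less than `m`, then `p` can be collapsed to rank `k + 1`; and `p` and `q` cannot both have rank
`m` as long as `k + n < 2 * m`, because the image of `q` has at most `k + (n - rank p)` points. Then
common refinements of kernels with `k + 2` classes connect everything to a normal form
(`map_mul_map_eq_normalForm`), for which `k + 2 ≤ m` and `k + 3 ≤ n` leave enough room. This settles
`r = 2 * m - n` for `m < n` and `r = n - 2` for `m = n`.

*Lower bounds.* Relations of rank above `k` preserve the property that a word can be cut into two
parts with values of a prescribed kind, provided that a cut inside a factor of rank above `k` can
always be moved to an end of this factor (`HasSplit.of_eval_eq`). For `m < n` and `2 * m ≤ n + k`,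
one prescribes the two values `p` and `q`, both of rank `m`, with `p * q` of rank `k`
(`le_relationalDepth_of_lt`): a factor `u₁ * u₂` with a cut inside would have rank at most `k`. For
`m = n` one prescribes the kernel of the first part, with `n - 1` classes
(`three_le_relationalDepth`). In both cases the value of the word has another factorization
`p' * q'` such that the kernels of `p` and `p'` are incomparable, and a word for `p'` followed by
one for `q'` has no cut of the prescribed kind (`not_forall_lt_rank`).
-/

/-! ### Ranks, kernels and images of transformations -/

namespace FullTransformation

variable {n : ℕ}

/-- The map underlying a transformation. -/
def act (α : FullTransformation n) : Fin n → Fin n := MulOpposite.unop α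

/-- The transformation with a given underlying map. -/
def ofFun (f : Fin n → Fin n) : FullTransformation n := MulOpposite.op f

@[simp] theorem act_ofFun (f : Fin n → Fin n) : act (ofFun f) = f := rfl

@[simp] theorem act_mul (α β : FullTransformation n) (i : Fin n) :
    act (α * β) i = act β (act α i) := rfl

theorem ext_act {α β : FullTransformation n} (h : ∀ i, act α i = act β i) : α = β :=
  MulOpposite.unop_injective (funext h)

theorem rank_eq (α : FullTransformation n) : rank α = (Set.range (act α)).ncard := rfl

theorem ncard_range_le_of_factorsThrough {X Y : Type*} {f : Fin n → X} {h : Fin n → Y}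
    (hfh : h.FactorsThrough f) : (Set.range h).ncard ≤ (Set.range f).ncard := by
  have hsub : Set.range h ⊆ (fun x : Set.range f => h (Set.rangeSplitting f x)) '' Set.univ := by
    rintro _ ⟨i, rfl⟩
    exact ⟨⟨f i, i, rfl⟩, trivial, hfh (Set.apply_rangeSplitting f _)⟩
  refine (Set.ncard_le_ncard hsub (Set.toFinite _)).trans ?_
  refine (Set.ncard_image_le (Set.toFinite _)).trans ?_
  rw [Set.ncard_univ]
  rfl

/-- A map whose kernel contains that of `f`, and whose image is not smaller, has the same kernel
as `f`. -/
theorem factorsThrough_of_ncard_le {X Y : Type*} {f : Fin n → X} {h : Fin n → Y}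
    (hfh : h.FactorsThrough f) (hle : (Set.range f).ncard ≤ (Set.range h).ncard) :
    f.FactorsThrough h := by
  rcases Nat.eq_zero_or_pos n with rfl | hn
  · exact fun i => i.elim0
  have : Nonempty Y := ⟨h ⟨0, hn⟩⟩
  obtain ⟨e, rfl⟩ := (Function.factorsThrough_iff h).1 hfh
  rw [Set.range_comp] at hle
  have hinj := (Set.ncard_image_iff (Set.toFinite (Set.range f))).1
    (le_antisymm (Set.ncard_image_le (Set.toFinite _)) hle)
  exact fun i j hij => hinj ⟨i, rfl⟩ ⟨j, rfl⟩ hij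

theorem rank_le_of_factorsThrough {α β : FullTransformation n}
    (h : (act β).FactorsThrough (act α)) : rank β ≤ rank α :=
  ncard_range_le_of_factorsThrough h

theorem factorsThrough_mul (α β : FullTransformation n) :
    (act (α * β)).FactorsThrough (act α) := fun i j h => by simp [h]

theorem range_mul (α β : FullTransformation n) :
    Set.range (act (α * β)) = act β '' Set.range (act α) := Set.range_comp (act β) (act α)

theorem range_mul_subset (α β : FullTransformation n) :
    Set.range (act (α * β)) ⊆ Set.range (act β) := by
  rw [range_mul]; exact Set.image_subset_range _ _

theorem rank_le_of_range_subset {α β : FullTransformation n}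
    (h : Set.range (act β) ⊆ Set.range (act α)) : rank β ≤ rank α :=
  Set.ncard_le_ncard h (Set.toFinite _)

theorem rank_mul_le_right (α β : FullTransformation n) : rank (α * β) ≤ rank β :=
  rank_le_of_range_subset (range_mul_subset α β)

theorem rank_le (α : FullTransformation n) : rank α ≤ n := by
  simpa [rank_eq] using Set.ncard_le_card (Set.range (act α))

theorem rank_pos (hn : 0 < n) (α : FullTransformation n) : 0 < rank α :=
  (Set.ncard_pos (Set.toFinite _)).2 ⟨act α ⟨0, hn⟩, ⟨0, hn⟩, rfl⟩

/-- If `β` identifies two points of the image of `α`, then the rank drops. -/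
theorem rank_mul_lt {α β : FullTransformation n} {i j : Fin n} (hne : act α i ≠ act α j)
    (heq : act (α * β) i = act (α * β) j) : rank (α * β) < rank α := by
  refine lt_of_not_ge fun hle => hne ?_
  exact factorsThrough_of_ncard_le (factorsThrough_mul α β) hle heq

theorem exists_identified_of_rank_lt {α β : FullTransformation n}
    (h : rank (α * β) < rank α) : ∃ i j, act α i ≠ act α j ∧ act (α * β) i = act (α * β) j := by
  by_contra! hcon
  refine absurd h (not_lt.2 ?_)
  exact rank_le_of_factorsThrough fun i j hij => by_contra fun hne => hcon i j hne hij

theorem exists_notMem_range {α : FullTransformation n} (h : rank α < n) :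
    ∃ y, y ∉ Set.range (act α) := by
  by_contra! hcon
  have : Set.range (act α) = Set.univ := Set.eq_univ_of_forall hcon
  rw [rank_eq, this] at h
  simp at h

/-- Every map on an `n`-element set has the same kernel as some transformation. -/
theorem exists_act_eq_iff {X : Type*} (f : Fin n → X) :
    ∃ α : FullTransformation n, (∀ i j, act α i = act α j ↔ f i = f j) ∧
      rank α = (Set.range f).ncard := by
  let g : Fin n → Fin n := fun i => Set.rangeSplitting f ⟨f i, Set.mem_range_self i⟩
  have hg : ∀ i j, g i = g j ↔ f i = f j := by
    intro i j
    exact (Set.rangeSplitting_injective f).eq_iff.trans Subtype.mk_eq_mk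
  refine ⟨ofFun g, hg, le_antisymm ?_ ?_⟩
  · exact ncard_range_le_of_factorsThrough fun i j h => (hg i j).2 h
  · exact ncard_range_le_of_factorsThrough fun i j h => (hg i j).1 h

/-- Refining the kernel of a map by splitting off part of one class adds at most one class. -/
theorem ncard_range_prodMk_le {X : Type*} (f : Fin n → X) (P : Fin n → Prop)
    (hP : ∀ i j, P i → P j → f i = f j) :
    (Set.range fun i => (f i, P i)).ncard ≤ (Set.range f).ncard + 1 := by
  by_cases h : ∃ c, P c
  · obtain ⟨c, hc⟩ := h
    have hsub : (Set.range fun i => (f i, P i)) ⊆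
        insert (f c, True) ((fun x => (x, False)) '' Set.range f) := by
      rintro _ ⟨i, rfl⟩
      by_cases hi : P i
      · left; simp [hi, hP i c hi hc]
      · right; exact ⟨f i, ⟨i, rfl⟩, by simp [hi]⟩
    refine (Set.ncard_le_ncard hsub (Set.toFinite _)).trans ?_
    refine (Set.ncard_insert_le _ _).trans ?_
    exact Nat.add_le_add_right (Set.ncard_image_le (Set.toFinite _)) 1
  · push Not at h
    refine (ncard_range_le_of_factorsThrough (h := fun i => (f i, P i)) (f := f)
      fun i j hij => ?_).trans (Nat.le_succ _)
    simp [hij, h i, h j]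

/-- The transformation that agrees with `h` along `p` (sending `act p i` to `h i`) and sends every
point outside the image of `p` to `z`. -/
noncomputable def extendBy (p : FullTransformation n) (h : Fin n → Fin n) (z : Fin n) :
    FullTransformation n := ofFun (Function.extend (act p) h fun _ => z)

theorem act_extendBy {p : FullTransformation n} {h : Fin n → Fin n}
    (hp : h.FactorsThrough (act p)) (z i : Fin n) : act (extendBy p h z) (act p i) = h i :=
  hp.extend_apply (fun _ => z) i

theorem mul_extendBy {p : FullTransformation n} {h : Fin n → Fin n}
    (hp : h.FactorsThrough (act p)) (z : Fin n) : p * extendBy p h z = ofFun h :=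
  ext_act fun i => act_extendBy hp z i

theorem act_extendBy_of_notMem {p : FullTransformation n} {h : Fin n → Fin n} {y z : Fin n}
    (hy : y ∉ Set.range (act p)) : act (extendBy p h z) y = z :=
  Function.extend_apply' h (fun _ => z) y hy

theorem extendBy_mul (p q : FullTransformation n) (h : Fin n → Fin n) (z : Fin n) :
    extendBy p h z * q = extendBy p (act q ∘ h) (act q z) :=
  ext_act fun i => Function.apply_extend (act q) (act p) (fun _ => z) i

theorem range_extendBy_subset (p : FullTransformation n) (h : Fin n → Fin n) (z : Fin n) :
    Set.range (act (extendBy p h z)) ⊆ insert z (Set.range h) := by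
  rintro _ ⟨i, rfl⟩
  by_cases hi : ∃ j, act p j = i
  · right
    exact ⟨Classical.choose hi, by simp [extendBy, Function.extend_def, hi]⟩
  · left; exact act_extendBy_of_notMem hi

theorem rank_extendBy_le (p : FullTransformation n) (h : Fin n → Fin n) (z : Fin n) :
    rank (extendBy p h z) ≤ (Set.range h).ncard + 1 :=
  (Set.ncard_le_ncard (range_extendBy_subset p h z) (Set.toFinite _)).trans
    (Set.ncard_insert_le _ _)

theorem rank_extendBy {p : FullTransformation n} {h : Fin n → Fin n} {z : Fin n}
    (hp : h.FactorsThrough (act p)) (hpn : rank p < n) (hz : z ∉ Set.range h) :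
    rank (extendBy p h z) = (Set.range h).ncard + 1 := by
  refine le_antisymm (rank_extendBy_le p h z) ?_
  rw [← Set.ncard_insert_of_notMem hz (Set.toFinite _)]
  obtain ⟨y, hy⟩ := exists_notMem_range hpn
  refine Set.ncard_le_ncard (Set.insert_subset ⟨y, act_extendBy_of_notMem hy⟩ ?_) (Set.toFinite _)
  rintro _ ⟨i, rfl⟩
  exact ⟨act p i, act_extendBy hp z i⟩

/-- Splitting one point off a non-trivial kernel class raises the rank by exactly one. -/
theorem exists_splitPoint {σ : FullTransformation n} {c d : Fin n} (hcd : c ≠ d)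
    (hσ : act σ c = act σ d) :
    ∃ e : FullTransformation n, (∀ i j, act e i = act e j ↔ act σ i = act σ j ∧ (i = d ↔ j = d)) ∧
      rank e = rank σ + 1 := by
  obtain ⟨e, he, her⟩ := exists_act_eq_iff fun i => (act σ i, i = d)
  refine ⟨e, by simpa using he, le_antisymm ?_ ?_⟩
  · rw [her]
    exact ncard_range_prodMk_le _ _ fun i j hi hj => by rw [hi, hj]
  · have hf : (act σ).FactorsThrough (act e) := fun i j h => by
      have := (he i j).1 h
      simp only [Prod.mk.injEq] at this
      exact this.1
    have hmul := mul_extendBy hf c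
    have := rank_mul_lt (α := e) (β := extendBy e (act σ) c) (i := c) (j := d)
      (fun h => hcd (by simpa [hσ] using (he c d).1 h)) (by rw [hmul]; exact hσ)
    rw [hmul] at this
    exact this

theorem exists_identified {σ : FullTransformation n} (h : rank σ < n) :
    ∃ c d, c ≠ d ∧ act σ c = act σ d := by
  by_contra! hcon
  have hinj : Function.Injective (act σ) := fun i j hij => by_contra fun hne => hcon i j hne hij
  rw [rank_eq, Set.ncard_range_of_injective hinj] at h
  simp at h

end FullTransformation

/-! ### Factorizations of a transformation into two factors of larger rank -/

namespace FullTransformation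

variable {n : ℕ} {Q : Type*} [Semigroup Q] {m k : ℕ} {g : FullTransformation n → Q}

/-- The basic move: `g` being multiplicative above rank `k`, the kernel of the left factor `p` may
be refined to that of `p₀`, and the right factor replaced by the one that sends everything outside
the image of `p₀` to a single point `z`. The factor moved across is the map that agrees with `p`
along `p₀` and sends all other points to a preimage of `z`. -/
theorem map_mul_map_eq_refine
    (hg : ∀ α β, rank α ≤ m → rank β ≤ m → k < rank (α * β) → g (α * β) = g α * g β)
    {p p₀ q : FullTransformation n} {z : Fin n} (hp : k < rank p) (hpm : rank p < m)
    (hp₀m : rank p₀ ≤ m) (hp₀n : rank p₀ < n) (href : (act p).FactorsThrough (act p₀))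
    (hqm : rank q ≤ m) (hσ : rank (p * q) = k) (hz : z ∈ Set.range (act q))
    (hzσ : z ∉ Set.range (act (p * q))) :
    g p * g q = g p₀ * g (extendBy p₀ (act (p * q)) z) := by
  obtain ⟨w, rfl⟩ := hz
  have hx : p₀ * extendBy p₀ (act p) w = p := mul_extendBy href w
  have hxq : extendBy p₀ (act p) w * q = extendBy p₀ (act (p * q)) (act q w) :=
    extendBy_mul p₀ q (act p) w
  have hxm : rank (extendBy p₀ (act p) w) ≤ m := (rank_extendBy_le p₀ (act p) w).trans hpm
  have hrank : rank (extendBy p₀ (act (p * q)) (act q w)) = k + 1 := by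
    rw [rank_extendBy (fun i j h => factorsThrough_mul p q (href h)) hp₀n hzσ, ← rank_eq, hσ]
  calc g p * g q = g p₀ * g (extendBy p₀ (act p) w) * g q := by
        rw [← hg _ _ hp₀m hxm (by rwa [hx]), hx]
    _ = g p₀ * g (extendBy p₀ (act (p * q)) (act q w)) := by
        rw [mul_assoc, ← hg _ _ hxm hqm (by rw [hxq, hrank]; exact Nat.lt_succ_self k), hxq]

theorem exists_mem_range_notMem {p q : FullTransformation n} (h : rank (p * q) < rank q) :
    ∃ z ∈ Set.range (act q), z ∉ Set.range (act (p * q)) := by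
  by_contra! hcon
  exact absurd (rank_le_of_range_subset (α := p * q) hcon) (not_le.2 h)

/-- The point `z` of the basic move does not matter when two points lie outside the image of `p`:
a right factor hitting both `z` and `z'` mediates. -/
theorem map_mul_map_extendBy_eq
    (hg : ∀ α β, rank α ≤ m → rank β ≤ m → k < rank (α * β) → g (α * β) = g α * g β)
    {p : FullTransformation n} {s : Fin n → Fin n} {z z' : Fin n} (hkm : k + 2 ≤ m)
    (hp : k < rank p) (hpm : rank p < m) (hpn : rank p + 2 ≤ n) (hs : s.FactorsThrough (act p))
    (hsk : (Set.range s).ncard = k) (hz : z ∉ Set.range s) (hz' : z' ∉ Set.range s) :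
    g p * g (extendBy p s z) = g p * g (extendBy p s z') := by
  obtain ⟨y, hy⟩ := exists_notMem_range (α := p) (by lia)
  obtain ⟨y', hyy', hy'⟩ : ∃ y', y' ≠ y ∧ y' ∉ Set.range (act p) := by
    by_contra! hcon
    have hsub : Set.univ ⊆ insert y (Set.range (act p)) := fun i _ => by
      by_cases hi : i = y
      · exact Or.inl hi
      · exact Or.inr (hcon i hi)
    have h1 := Set.ncard_le_ncard hsub (Set.toFinite _)
    have h2 := Set.ncard_insert_le y (Set.range (act p))
    rw [← rank_eq] at h2
    simp only [Set.ncard_univ, Nat.card_eq_fintype_card, Fintype.card_fin] at h1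
    lia
  let q : FullTransformation n := ofFun (Function.update (act (extendBy p s z)) y' z')
  have hpq : p * q = ofFun s := ext_act fun i => by
    have : act p i ≠ y' := fun h => hy' ⟨i, h⟩
    simp [q, Function.update_of_ne this, act_extendBy hs]
  have hqy : act q y = z := by
    simp [q, Function.update_of_ne hyy'.symm, act_extendBy_of_notMem hy]
  have hqy' : act q y' = z' := by simp [q]
  have hqm : rank q ≤ m := by
    have hsub : Set.range (act q) ⊆ insert z' (insert z (Set.range s)) := by
      rintro _ ⟨i, rfl⟩
      by_cases hi : i = y'
      · exact Or.inl (hi ▸ hqy')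
      · refine Or.inr ?_
        simp only [q, act_ofFun, Function.update_of_ne hi]
        exact range_extendBy_subset p s z ⟨i, rfl⟩
    have h1 := Set.ncard_le_ncard hsub (Set.toFinite _)
    have h2 := Set.ncard_insert_le z' (insert z (Set.range s))
    have h3 := Set.ncard_insert_le z (Set.range s)
    rw [rank_eq]
    lia
  have key : ∀ x ∈ Set.range (act q), x ∉ Set.range s →
      g p * g q = g p * g (extendBy p s x) := fun x hx hxs => by
    have := map_mul_map_eq_refine hg hp hpm hpm.le (by lia) (fun i j h => h) hqm
      (by rw [hpq]; exact hsk) hx (by rw [hpq]; exact hxs)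
    rwa [hpq] at this
  rw [← key z ⟨y, hqy⟩ hz, ← key z' ⟨y', hqy'⟩ hz']

/-- If the right factor `q` has rank less than `m`, the left factor can be reduced to rank `k + 1`:
each kernel class of `q` is collapsed to a point before applying `q`, except that one class keeps
two points, and this keeps the rank of the left factor above `k`. -/
theorem exists_left_rank_eq_succ
    (hg : ∀ α β, rank α ≤ m → rank β ≤ m → k < rank (α * β) → g (α * β) = g α * g β)
    {p q : FullTransformation n} (hp : k < rank p) (hpm : rank p ≤ m) (hq : k < rank q)
    (hqm : rank q < m) (hσ : rank (p * q) = k) :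
    ∃ p' q' : FullTransformation n, p' * q' = p * q ∧ rank p' = k + 1 ∧ k < rank q' ∧
      rank q' ≤ m ∧ g p * g q = g p' * g q' := by
  obtain ⟨a, b, hab, habq⟩ := exists_identified_of_rank_lt (hσ ▸ hp : rank (p * q) < rank p)
  obtain ⟨x, hx, hxr⟩ := exists_splitPoint hab habq
  have hxq : (act q).FactorsThrough (act x) := fun i j h => ((hx i j).1 h).1
  let q' := extendBy x (act q) (act q a)
  have hq' : x * q' = q := mul_extendBy hxq _
  have hpx : p * x * q' = p * q := by rw [mul_assoc, hq']
  have hrank : rank (p * x) = k + 1 := by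
    refine le_antisymm ?_ ?_
    · have hker : (act (p * x)).FactorsThrough
          (fun i => (act (p * q) i, act p i = act p b)) := fun i j h => by
        simp only [Prod.mk.injEq, eq_iff_iff] at h
        exact (hx _ _).2 h
      refine (rank_eq _).trans_le ((ncard_range_le_of_factorsThrough hker).trans ?_)
      rw [← hσ]
      exact ncard_range_prodMk_le _ _ fun i j hi hj => by simp [hi, hj]
    · have hne : act (p * x) a ≠ act (p * x) b := fun h => by
        have := ((hx _ _).1 h).2
        exact hab (this.2 rfl)
      have := rank_mul_lt (β := q') hne (by rw [hpx]; exact habq)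
      rwa [hpx, hσ] at this
  have hq'm : rank q' ≤ m := by
    refine le_trans ?_ hqm.le
    refine Set.ncard_le_ncard ((range_extendBy_subset _ _ _).trans ?_) (Set.toFinite _)
    exact Set.insert_subset ⟨a, rfl⟩ subset_rfl
  have hxm : rank x ≤ m := by lia
  refine ⟨p * x, q', hpx, hrank, ?_, hq'm, ?_⟩
  · exact hq.trans_le (by rw [← hq']; exact rank_mul_le_right x q')
  · rw [hg p x hpm hxm (by lia), mul_assoc, ← hg x q' hxm hq'm (by rwa [hq']), hq']

/-- The image of the right factor is covered by the image of the product and the values at points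
outside the image of the left factor. -/
theorem rank_right_add_rank_left_le (p q : FullTransformation n) :
    rank q + rank p ≤ rank (p * q) + n := by
  have hsub : Set.range (act q) ⊆
      Set.range (act (p * q)) ∪ act q '' (Set.range (act p))ᶜ := by
    rw [range_mul, ← Set.image_union, Set.union_compl_self, Set.image_univ]
  have h1 := Set.ncard_le_ncard hsub (Set.toFinite _)
  have h2 := Set.ncard_union_le (Set.range (act (p * q))) (act q '' (Set.range (act p))ᶜ)
  have h3 := Set.ncard_image_le (f := act q) (Set.toFinite (Set.range (act p))ᶜ)
  have h4 := Set.ncard_add_ncard_compl (Set.range (act p)) (Set.toFinite _) (Set.toFinite _)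
  simp only [← rank_eq, Nat.card_eq_fintype_card, Fintype.card_fin] at h1 h2 h3 h4
  lia

/-- A normal form for factorizations of `σ`: the left factor splits the point `d` off its kernel
class, and the right factor adds the point `z` to the image. -/
theorem map_mul_map_eq_normalForm
    (hg : ∀ α β, rank α ≤ m → rank β ≤ m → k < rank (α * β) → g (α * β) = g α * g β)
    (hkm : k + 2 ≤ m) (hkn : k + 3 ≤ n) (hkmn : k + n < 2 * m)
    {σ e p q : FullTransformation n} {d z : Fin n} (hσ : rank σ = k)
    (he : ∀ i j, act e i = act e j ↔ act σ i = act σ j ∧ (i = d ↔ j = d)) (her : rank e = k + 1)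
    (hz : z ∉ Set.range (act σ)) (hp : k < rank p) (hpm : rank p ≤ m) (hq : k < rank q)
    (hqm : rank q ≤ m) (hpq : p * q = σ) :
    g p * g q = g e * g (extendBy e (act σ) z) := by
  have hσn : rank σ < n := by lia
  have hrank : ∀ {p' : FullTransformation n} (w : Fin n), (act σ).FactorsThrough (act p') →
      rank p' < n → w ∉ Set.range (act σ) → rank (extendBy p' (act σ) w) = k + 1 :=
    fun w h1 h2 h3 => by rw [rank_extendBy h1 h2 h3, ← rank_eq, hσ]
  -- By `rank_right_add_rank_left_le`, not both factors have rank `m`; so the basic move applies when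
  -- the right factor has rank `m`, and replaces it by one of rank `k + 1`.
  wlog hqm' : rank q < m generalizing p q
  · have hpm' : rank p < m := by
      have := rank_right_add_rank_left_le p q
      rw [hpq, hσ] at this
      lia
    have hpn : rank p < n := hpm'.trans_le ((not_lt.1 hqm').trans (rank_le q))
    have hpσ : (act σ).FactorsThrough (act p) := hpq ▸ factorsThrough_mul p q
    obtain ⟨w, hw, hwσ⟩ := exists_mem_range_notMem (p := p) (q := q) (by rwa [hpq, hσ])
    rw [hpq] at hwσ
    have hr := hrank w hpσ hpn hwσ
    rw [map_mul_map_eq_refine hg hp hpm' hpm hpn (fun i j h => h) hqm (by rw [hpq, hσ]) hw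
      (by rwa [hpq]), hpq]
    exact this hp hpm (by lia) (by lia) (mul_extendBy hpσ w) (by lia)
  obtain ⟨p', q', hpq', hp'r, hq', hq'm, heq⟩ :=
    exists_left_rank_eq_succ hg hp hpm hq hqm' (by rw [hpq, hσ])
  rw [hpq] at hpq'
  rw [heq]
  have hσp' : (act σ).FactorsThrough (act p') := hpq' ▸ factorsThrough_mul p' q'
  obtain ⟨w, hw, hwσ⟩ := exists_mem_range_notMem (p := p') (q := q') (by rwa [hpq', hσ])
  rw [hpq'] at hwσ
  -- `f` refines both `p'` and `e`.
  obtain ⟨f, hf, hfr⟩ := exists_act_eq_iff fun i => (act p' i, i = d)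
  simp only [Prod.mk.injEq, eq_iff_iff] at hf
  have hfr' : rank f ≤ k + 2 := by
    rw [hfr, show k + 2 = (Set.range (act p')).ncard + 1 by rw [← rank_eq]; lia]
    exact ncard_range_prodMk_le _ _ fun i j hi hj => by rw [hi, hj]
  have hσe : (act σ).FactorsThrough (act e) := fun i j h => ((he i j).1 h).1
  have key : ∀ {p₀ : FullTransformation n}, rank p₀ = k + 1 → (act σ).FactorsThrough (act p₀) →
      (act p₀).FactorsThrough (act f) →
      g p₀ * g (extendBy p₀ (act σ) z) = g f * g (extendBy f (act σ) z) := by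
    intro p₀ hr h1 h2
    obtain ⟨y, hy⟩ := exists_notMem_range (α := p₀) (by lia)
    have hmul : p₀ * extendBy p₀ (act σ) z = σ := mul_extendBy h1 z
    have := map_mul_map_eq_refine hg (p := p₀) (p₀ := f) (q := extendBy p₀ (act σ) z) (z := z)
      (by lia) (by lia) (by lia) (by lia) h2 (by rw [hrank z h1 (by lia) hz]; lia)
      (by rw [hmul, hσ]) ⟨y, act_extendBy_of_notMem hy⟩ (by rwa [hmul])
    rwa [hmul] at this
  calc g p' * g q' = g p' * g (extendBy p' (act σ) w) := by
        have := map_mul_map_eq_refine hg (p := p') (p₀ := p') (by lia) (by lia) (by lia) (by lia)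
          (fun i j h => h) hq'm (by rw [hpq', hσ]) hw (by rwa [hpq'])
        rwa [hpq'] at this
    _ = g p' * g (extendBy p' (act σ) z) :=
        map_mul_map_extendBy_eq hg hkm (by lia) (by lia) (by lia) hσp' hσ hwσ hz
    _ = g f * g (extendBy f (act σ) z) := key hp'r hσp' fun i j h => ((hf i j).1 h).1
    _ = g e * g (extendBy e (act σ) z) := Eq.symm <| key her hσe fun i j h =>
        (he i j).2 ⟨hσp' ((hf i j).1 h).1, ((hf i j).1 h).2⟩

/-- A map that is multiplicative above rank `k` takes the same value on all factorizations of a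
transformation of rank `k` into two factors of larger rank. -/
theorem map_mul_map_eq
    (hg : ∀ α β, rank α ≤ m → rank β ≤ m → k < rank (α * β) → g (α * β) = g α * g β)
    (hkm : k + 2 ≤ m) (hkn : k + 3 ≤ n) (hkmn : k + n < 2 * m)
    {p q p' q' : FullTransformation n} (hσ : rank (p * q) = k) (hp : k < rank p) (hpm : rank p ≤ m)
    (hq : k < rank q) (hqm : rank q ≤ m) (hp' : k < rank p') (hpm' : rank p' ≤ m)
    (hq' : k < rank q') (hqm' : rank q' ≤ m) (heq : p * q = p' * q') :
    g p * g q = g p' * g q' := by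
  obtain ⟨c, d, hcd, hσcd⟩ := exists_identified (σ := p * q) (by lia)
  obtain ⟨e, he, her⟩ := exists_splitPoint hcd hσcd
  obtain ⟨z, hz⟩ := exists_notMem_range (α := p * q) (by lia)
  rw [hσ] at her
  rw [map_mul_map_eq_normalForm hg hkm hkn hkmn hσ he her hz hp hpm hq hqm rfl,
    map_mul_map_eq_normalForm hg hkm hkn hkmn hσ he her hz hp' hpm' hq' hqm' heq.symm]

/-- Every transformation of rank at most `n - 2` is a product of two factors of rank one more. If
left multiplication by `x` does not lower its rank, and `x` has larger rank, then the left factor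
can be chosen so that its product with `x` has larger rank too. -/
theorem exists_factorization {x σ : FullTransformation n} (hσn : rank σ + 2 ≤ n)
    (hx : rank σ < rank x) (hxσ : rank (x * σ) = rank σ) :
    ∃ p q : FullTransformation n, p * q = σ ∧ rank p = rank σ + 1 ∧ rank q = rank σ + 1 ∧
      rank σ < rank (x * p) := by
  obtain ⟨c, d, hcd, hσcd⟩ := exists_identified_of_rank_lt (α := x) (β := σ) (by lia)
  obtain ⟨e, he, her⟩ := exists_splitPoint hcd hσcd
  obtain ⟨z, hz⟩ := exists_notMem_range (α := σ) (by lia)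
  have hσe : (act σ).FactorsThrough (act e) := fun i j h => ((he i j).1 h).1
  have hmul : e * extendBy e (act σ) z = σ := mul_extendBy hσe z
  refine ⟨e, extendBy e (act σ) z, hmul, her, rank_extendBy hσe (by lia) hz, ?_⟩
  have hne : act (x * e) c ≠ act (x * e) d := fun h => hcd (((he _ _).1 h).2.2 rfl)
  have := rank_mul_lt (α := x * e) (β := extendBy e (act σ) z) hne
    (by rw [mul_assoc, hmul]; exact hσcd)
  rwa [mul_assoc, hmul, hxσ] at this

end FullTransformation

/-! ### Depth in the ideal of transformations of bounded rank -/

namespace FullTransformation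

variable {n m : ℕ}

/-- The transformation `i ↦ min i (r - 1)` of `{0, …, n - 1}`. -/
def cap (n r : ℕ) : FullTransformation n := ofFun fun i => ⟨min i (r - 1), by lia⟩

theorem act_cap (r : ℕ) (i : Fin n) : (act (cap n r) i : ℕ) = min (i : ℕ) (r - 1) := rfl

theorem range_cap {r : ℕ} (hr : 0 < r) : Set.range (act (cap n r)) = {y : Fin n | (y : ℕ) < r} := by
  ext y
  constructor
  · rintro ⟨i, rfl⟩
    rw [Set.mem_ofPred_eq, act_cap]
    lia
  · intro hy
    rw [Set.mem_ofPred_eq] at hy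
    exact ⟨y, Fin.ext (by rw [act_cap]; lia)⟩

theorem rank_cap {r : ℕ} (hr : 0 < r) (hrn : r ≤ n) : rank (cap n r) = r := by
  have : {y : Fin n | (y : ℕ) < r} = Set.range (Fin.castLE hrn) := by
    rw [Fin.range_castLE]
  rw [rank_eq, range_cap hr, this, Set.ncard_range_of_injective (Fin.castLE_injective hrn)]
  simp

/-- A transformation of rank at most that of `β` factors through `β`, with outer factors of no
larger rank than itself. -/
theorem exists_eq_mul_mul_of_rank_le {α β : FullTransformation n} (h : rank α ≤ rank β) :
    ∃ γ δ : FullTransformation n, rank γ ≤ rank α ∧ rank δ ≤ rank α ∧ α = γ * β * δ := by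
  rcases Nat.eq_zero_or_pos n with rfl | hn
  · exact ⟨α, α, le_rfl, le_rfl, ext_act fun i => i.elim0⟩
  obtain ⟨f, hf, hinj⟩ : ∃ f : Fin n → Fin n, Set.MapsTo f (Set.range (act α)) (Set.range (act β)) ∧
      Set.InjOn f (Set.range (act α)) := by
    have : Nonempty (Fin n) := ⟨⟨0, hn⟩⟩
    obtain ⟨f, h1, h2⟩ := (Set.toFinite (Set.range (act α))).exists_injOn_of_encard_le
      (t := Set.range (act β)) (by
        rw [← (Set.toFinite (Set.range (act α))).cast_ncard_eq,
          ← (Set.toFinite (Set.range (act β))).cast_ncard_eq]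
        exact_mod_cast h)
    exact ⟨f, h1, h2⟩
  have hf' : ∀ y, y ∈ Set.range (act α) → ∃ a, act β a = f y := fun y hy => hf hy
  choose! s hs using hf'
  let γ : FullTransformation n := ofFun fun i => s (act α i)
  have hγβ : ∀ i, act (γ * β) i = f (act α i) := fun i => hs _ ⟨i, rfl⟩
  have hfac : (act α).FactorsThrough (act (γ * β)) := fun i j hij => by
    rw [hγβ, hγβ] at hij
    exact hinj ⟨i, rfl⟩ ⟨j, rfl⟩ hij
  refine ⟨γ, extendBy (γ * β) (act α) (act α ⟨0, hn⟩),
    rank_le_of_factorsThrough fun i j hij => by simp [γ, hij], ?_, (mul_extendBy hfac _).symm⟩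
  exact rank_le_of_range_subset
    ((range_extendBy_subset _ _ _).trans (Set.insert_subset ⟨_, rfl⟩ subset_rfl))

/-- The principal ideals of `rankIdeal n m` are determined by the rank. -/
theorem mem_principalIdeal_iff (x z : rankIdeal n m) :
    z ∈ principalIdeal x ↔ rank (z : FullTransformation n) ≤ rank (x : FullTransformation n) := by
  constructor
  · rintro ⟨a, b, h⟩
    have hr : ∀ (s : rankIdeal n m) (b : WithOne (rankIdeal n m)),
        (z : WithOne (rankIdeal n m)) = (s : WithOne (rankIdeal n m)) * b →
        rank (z : FullTransformation n) ≤ rank (s : FullTransformation n) := by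
      intro s b hb
      rcases eq_or_ne b 1 with rfl | hb'
      · rw [mul_one, WithOne.coe_inj] at hb
        rw [hb]
      · obtain ⟨b, rfl⟩ := WithOne.ne_one_iff_exists.1 hb'
        rw [← WithOne.coe_mul, WithOne.coe_inj] at hb
        rw [hb]
        exact rank_mul_le_left _ _
    rcases eq_or_ne a 1 with rfl | ha
    · rw [one_mul] at h
      exact hr _ _ h
    · obtain ⟨a, rfl⟩ := WithOne.ne_one_iff_exists.1 ha
      rw [← WithOne.coe_mul] at h
      exact (hr _ _ h).trans (rank_mul_le_right _ _)
  · intro h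
    obtain ⟨γ, δ, hγ, hδ, heq⟩ := exists_eq_mul_mul_of_rank_le h
    refine ⟨((⟨γ, hγ.trans z.2⟩ : rankIdeal n m) : WithOne _),
      ((⟨δ, hδ.trans z.2⟩ : rankIdeal n m) : WithOne _), ?_⟩
    rw [← WithOne.coe_mul, ← WithOne.coe_mul, WithOne.coe_inj]
    exact Subtype.ext heq

theorem principalIdeal_subset_iff (x y : rankIdeal n m) :
    principalIdeal x ⊆ principalIdeal y ↔
      rank (x : FullTransformation n) ≤ rank (y : FullTransformation n) :=
  ⟨fun h => (mem_principalIdeal_iff y x).1 (h ((mem_principalIdeal_iff x x).2 le_rfl)),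
    fun h z hz => (mem_principalIdeal_iff y z).2 (((mem_principalIdeal_iff x z).1 hz).trans h)⟩

/-- The `𝒥`-classes above that of `x` correspond to the ranks from `rank x` to `m`. -/
theorem elementDepth_eq (hn : 0 < n) (hmn : m ≤ n) (x : rankIdeal n m) :
    elementDepth x = ((m + 1 - rank (x : FullTransformation n) : ℕ) : ℕ∞) := by
  let ρ : JClass (rankIdeal n m) → ℕ :=
    Quotient.lift (fun s : rankIdeal n m => rank (s : FullTransformation n)) fun a b hab => by
      have h : principalIdeal a = principalIdeal b := hab
      exact le_antisymm ((principalIdeal_subset_iff a b).1 h.subset)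
        ((principalIdeal_subset_iff b a).1 h.symm.subset)
  have hρ : ∀ J K : JClass (rankIdeal n m), J ≤ K ↔ ρ J ≤ ρ K := by
    intro J K
    induction J using Quotient.inductionOn with
    | h a =>
      induction K using Quotient.inductionOn with
      | h b => exact principalIdeal_subset_iff a b
  have hinj : Function.Injective ρ := fun J K h =>
    le_antisymm ((hρ J K).2 h.le) ((hρ K J).2 h.ge)
  have himage : ρ '' {K | Quotient.mk (greenJ (rankIdeal n m)) x ≤ K} =
      Finset.Icc (rank (x : FullTransformation n)) m := by
    ext r
    simp only [Set.mem_image, Set.mem_ofPred_eq, Finset.coe_Icc, Set.mem_Icc]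
    constructor
    · rintro ⟨K, hK, rfl⟩
      induction K using Quotient.inductionOn with
      | h b => exact ⟨(hρ _ _).1 hK, b.2⟩
    · rintro ⟨h1, h2⟩
      have hα : rank (cap n r) = r := rank_cap (lt_of_lt_of_le (rank_pos hn _) h1) (h2.trans hmn)
      refine ⟨Quotient.mk _ (⟨cap n r, hα.trans_le h2⟩ : rankIdeal n m), (hρ _ _).2 ?_, hα⟩
      exact h1.trans hα.ge
  rw [elementDepth, JClass.depth, ← hinj.encard_image, himage, Set.encard_coe_eq_coe_finsetCard,
    Nat.card_Icc]

end FullTransformation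

/-! ### A presentation whose relations all have large rank -/

namespace FullTransformation

variable {n m : ℕ}

/-- If the words of rank above `k` over elements of rank above `k` are determined, up to a
congruence, by their values, then so are the words of rank `k`. -/
theorem con_of_value_eq {k : ℕ} {G : Type*} {c : Con (FreeSemigroup G)}
    {ev : FreeSemigroup G →ₙ* FullTransformation n}
    (hkm : k + 2 ≤ m) (hkn : k + 3 ≤ n) (hkmn : k + n < 2 * m)
    (hev : ∀ w, rank (ev w) ≤ m) (hgen : ∀ a, k < rank (ev (FreeSemigroup.of a)))
    (hsurj : ∀ α : FullTransformation n, rank α ≤ m → ∃ w, ev w = α)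
    (hc : ∀ u v, ev u = ev v → k < rank (ev u) → c u v)
    {u v : FreeSemigroup G} (huv : ev u = ev v) (hu : rank (ev u) = k) : c u v := by
  have hchoice : ∀ α : FullTransformation n, ∃ w, rank α ≤ m → ev w = α := fun α => by
    by_cases h : rank α ≤ m
    · obtain ⟨w, hw⟩ := hsurj α h
      exact ⟨w, fun _ => hw⟩
    · exact ⟨u, fun h' => absurd h' h⟩
  choose s hs using hchoice
  let g : FullTransformation n → c.Quotient := fun α => (s α : c.Quotient)
  have hgw : ∀ w, k < rank (ev w) → (w : c.Quotient) = g (ev w) := fun w hw =>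
    (Con.eq c).2 (hc _ _ (hs _ (hev w)).symm hw)
  have hg : ∀ α β, rank α ≤ m → rank β ≤ m → k < rank (α * β) → g (α * β) = g α * g β := by
    intro α β hα hβ hαβ
    have h : ev (s α * s β) = α * β := by rw [map_mul, hs α hα, hs β hβ]
    rw [← h, ← hgw _ (by rwa [h]), Con.coe_mul]
  -- every word of rank `k` is congruent to a product of two words of larger rank
  have hsplit : ∀ w, rank (ev w) = k → ∃ p q : FullTransformation n, p * q = ev w ∧
      k < rank p ∧ rank p ≤ m ∧ k < rank q ∧ rank q ≤ m ∧ (w : c.Quotient) = g p * g q := by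
    intro w
    induction w using FreeSemigroup.recOnMul with
    | ih1 a => exact fun h => absurd h (hgen a).ne'
    | ih2 a w _ ih =>
      intro h
      have hmul : ev (FreeSemigroup.of a * w) = ev (FreeSemigroup.of a) * ev w := map_mul _ _ _
      rw [hmul] at h ⊢
      rcases (h ▸ rank_mul_le_right _ _ : k ≤ rank (ev w)).lt_or_eq with hw | hw
      · refine ⟨_, _, rfl, hgen a, hev _, hw, hev _, ?_⟩
        rw [Con.coe_mul, hgw _ (hgen a), hgw _ hw]
      · obtain ⟨p', q', hpq', hp', hpm', hq', hqm', heq'⟩ := ih hw.symm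
        obtain ⟨p, q, hpq, hp, hq, hxp⟩ := exists_factorization (x := ev (FreeSemigroup.of a))
          (σ := ev w) (by lia) (by rw [← hw]; exact hgen a) (by rw [h, hw])
        have hxm : rank (ev (FreeSemigroup.of a) * p) ≤ m :=
          (rank_mul_le_left _ _).trans (hev _)
        refine ⟨ev (FreeSemigroup.of a) * p, q, by rw [mul_assoc, hpq], by lia, hxm, by lia,
          by lia, ?_⟩
        rw [Con.coe_mul, heq', map_mul_map_eq hg hkm hkn hkmn (by rw [hpq', hw]) hp' hpm' hq' hqm'
          (p' := p) (q' := q) (by lia) (by lia) (by lia) (by lia) (by rw [hpq, hpq']),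
          hgw _ (hgen a), hg _ _ (hev _) (by lia) (by lia), mul_assoc]
  obtain ⟨p, q, hpq, hp, hpm, hq, hqm, heq⟩ := hsplit u hu
  obtain ⟨p', q', hpq', hp', hpm', hq', hqm', heq'⟩ := hsplit v (huv ▸ hu)
  refine (Con.eq c).1 ?_
  rw [heq, heq']
  exact map_mul_map_eq hg hkm hkn hkmn (by rw [hpq, hu]) hp hpm hq hqm hp' hpm' hq' hqm'
    (by rw [hpq, hpq', huv])

/-- The elements of `rankIdeal n m` of rank at least `r`, used as an alphabet. -/
abbrev RankGen (n m r : ℕ) : Type := {α : rankIdeal n m // r ≤ rank (α : FullTransformation n)}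

/-- The value in `rankIdeal n m` of a word in its elements of rank at least `r`. -/
def wordValue (n m r : ℕ) : FreeSemigroup (RankGen n m r) →ₙ* rankIdeal n m :=
  FreeSemigroup.lift Subtype.val

theorem wordValue_surjective {r : ℕ} (hrm : r ≤ m) (hr : ∀ k, 0 < k → k < r → k + 3 ≤ n)
    (hn : 0 < n) : Function.Surjective (wordValue n m r) := by
  suffices ∀ d (α : rankIdeal n m), r ≤ rank (α : FullTransformation n) + d →
      ∃ w, wordValue n m r w = α from fun α => this r α (Nat.le_add_left _ _)
  intro d
  induction d with
  | zero => exact fun α h => ⟨FreeSemigroup.of ⟨α, h⟩, rfl⟩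
  | succ d ih =>
    intro α h
    rcases le_or_gt r (rank (α : FullTransformation n)) with h' | h'
    · exact ⟨FreeSemigroup.of ⟨α, h'⟩, rfl⟩
    · have hαn := hr _ (rank_pos hn _) h'
      obtain ⟨p, q, hpq, hp, hq, -⟩ := exists_factorization (x := 1)
        (σ := (α : FullTransformation n)) (by lia) (by
          rw [rank_eq 1, show act (1 : FullTransformation n) = id from rfl, Set.range_id]
          simp only [Set.ncard_univ, Nat.card_eq_fintype_card, Fintype.card_fin]
          lia) (by rw [one_mul])
      obtain ⟨u, hu⟩ := ih ⟨p, show rank p ≤ m by lia⟩ (show r ≤ rank p + d by lia)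
      obtain ⟨v, hv⟩ := ih ⟨q, show rank q ≤ m by lia⟩ (show r ≤ rank q + d by lia)
      exact ⟨u * v, by rw [map_mul, hu, hv]; exact Subtype.ext hpq⟩

/-- The defining relations: all valid relations of rank at least `r`. -/
def rankRels (n m r : ℕ) : Set (FreeSemigroup (RankGen n m r) × FreeSemigroup (RankGen n m r)) :=
  {x | wordValue n m r x.1 = wordValue n m r x.2 ∧
    r ≤ rank (wordValue n m r x.1 : FullTransformation n)}

theorem conGen_rankRels_iff {r : ℕ} (hrm : r ≤ m) (hn : 0 < n)
    (hr : ∀ k, 0 < k → k < r → k + 2 ≤ m ∧ k + 3 ≤ n ∧ k + n < 2 * m)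
    (u v : FreeSemigroup (RankGen n m r)) :
    conGen (fun u v => (u, v) ∈ rankRels n m r) u v ↔
      wordValue n m r u = wordValue n m r v := by
  set c := conGen (fun u v => (u, v) ∈ rankRels n m r) with hcdef
  constructor
  · let d : Con (FreeSemigroup (RankGen n m r)) := Con.ker (wordValue n m r)
    have hle : c ≤ d := Con.conGen_le.2 fun u v h => h.1
    exact fun h => hle h
  · -- descending induction on the rank of the common value
    suffices ∀ d u v, wordValue n m r u = wordValue n m r v →
        r ≤ rank (wordValue n m r u : FullTransformation n) + d → c u v from
      fun h => this r u v h (Nat.le_add_left _ _)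
    intro d
    induction d with
    | zero => exact fun u v h h' => ConGen.Rel.of _ _ ⟨h, h'⟩
    | succ d ih =>
      intro u v h h'
      by_cases h'' : r ≤ rank (wordValue n m r u : FullTransformation n) + d
      · exact ih u v h h''
      obtain ⟨h1, h2, h3⟩ := hr (rank (wordValue n m r u : FullTransformation n))
        (rank_pos hn _) (by lia)
      refine con_of_value_eq (c := c) (m := m)
        (ev := (MulMemClass.subtype (rankIdeal n m)).comp (wordValue n m r))
        h1 h2 h3 (fun w => (wordValue n m r w).2)
        (fun a => lt_of_lt_of_le (by lia) a.2) ?_ ?_ (congrArg Subtype.val h) rfl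
      · intro α hα
        obtain ⟨w, hw⟩ := wordValue_surjective hrm (fun k h1 h2 => (hr k h1 h2).2.1) hn
          (⟨α, hα⟩ : rankIdeal n m)
        exact ⟨w, congrArg Subtype.val hw⟩
      · intro u' v' he hk
        change rank _ < rank (wordValue n m r u' : FullTransformation n) at hk
        exact ih u' v' (Subtype.ext he) (by lia)

/-- The presentation of `rankIdeal n m` by its elements of rank at least `r` and all valid relations
of rank at least `r`. -/
noncomputable def rankPresentation {r : ℕ} (hrm : r ≤ m) (hn : 0 < n)
    (hr : ∀ k, 0 < k → k < r → k + 2 ≤ m ∧ k + 3 ≤ n ∧ k + n < 2 * m) :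
    SemigroupPresentation (rankIdeal n m) where
  Gen := RankGen n m r
  finite_gen := Finite.of_injective (fun a : RankGen n m r => act a.1.1) fun a b h =>
    Subtype.ext (Subtype.ext (ext_act (congrFun h)))
  rels := rankRels n m r
  iso := MulEquiv.ofBijective
    (⟨fun q => Con.liftOn q (wordValue n m r) fun u v h => (conGen_rankRels_iff hrm hn hr u v).1 h,
      fun x y => Con.induction_on₂ x y fun u v => map_mul (wordValue n m r) u v⟩ :
      (conGen fun u v => (u, v) ∈ rankRels n m r).Quotient →ₙ* rankIdeal n m)
    ⟨fun x y => Con.induction_on₂ x y fun u v h =>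
        (Con.eq _).2 ((conGen_rankRels_iff hrm hn hr u v).2 h),
      fun α => by
        obtain ⟨w, hw⟩ := wordValue_surjective hrm (fun k h1 h2 => (hr k h1 h2).2.1) hn α
        exact ⟨w, hw⟩⟩

theorem relationalDepth_rankIdeal_le {r : ℕ} (hrm : r ≤ m) (hmn : m ≤ n) (hn : 0 < n)
    (hr : ∀ k, 0 < k → k < r → k + 2 ≤ m ∧ k + 3 ≤ n ∧ k + n < 2 * m) :
    relationalDepth (rankIdeal n m) ≤ ((m + 1 - r : ℕ) : ℕ∞) := by
  refine (iInf_le _ (rankPresentation hrm hn hr)).trans (iSup₂_le fun x hx => ?_)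
  have hval : (rankPresentation hrm hn hr).eval x.1 = wordValue n m r x.1 := rfl
  rw [SemigroupPresentation.wordDepth, hval, elementDepth_eq hn hmn]
  exact_mod_cast Nat.sub_le_sub_left hx.2 _

end FullTransformation

/-! ### Splittings of words that relations of large rank preserve -/

/-- The letters of a word of a free semigroup, as a list. -/
def FreeSemigroup.letters {G : Type*} (w : FreeSemigroup G) : List G := w.head :: w.tail

theorem FreeSemigroup.letters_mul {G : Type*} (u v : FreeSemigroup G) :
    (u * v).letters = u.letters ++ v.letters := rfl

namespace SemigroupPresentation

theorem eval_mul {S : Type*} [Semigroup S] (P : SemigroupPresentation S)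
    (u v : FreeSemigroup P.Gen) : P.eval (u * v) = P.eval u * P.eval v := by
  simp only [eval, Con.coe_mul, map_mul]

theorem eval_surjective {S : Type*} [Semigroup S] (P : SemigroupPresentation S) (s : S) :
    ∃ w, P.eval w = s := by
  obtain ⟨q, rfl⟩ := P.iso.surjective s
  obtain ⟨w, rfl⟩ := Quotient.exists_rep q
  exact ⟨w, rfl⟩

theorem eval_eq_iff {S : Type*} [Semigroup S] (P : SemigroupPresentation S)
    (u v : FreeSemigroup P.Gen) :
    P.eval u = P.eval v ↔ conGen (fun u v => (u, v) ∈ P.rels) u v :=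
  P.iso.injective.eq_iff.trans (Con.eq _)

open FullTransformation

variable {n m k : ℕ} (P : SemigroupPresentation (rankIdeal n m))

/-- The transformation represented by a list of generators; the empty list represents the identity
map, which need not lie in `rankIdeal n m`. -/
def listValue (l : List P.Gen) : FullTransformation n :=
  (l.map fun a => (P.eval (FreeSemigroup.of a) : FullTransformation n)).prod

theorem listValue_append (l l' : List P.Gen) :
    P.listValue (l ++ l') = P.listValue l * P.listValue l' := by
  simp [listValue]

theorem listValue_letters (w : FreeSemigroup P.Gen) :
    P.listValue w.letters = (P.eval w : FullTransformation n) := by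
  induction w using FreeSemigroup.recOnMul with
  | ih1 a => simp [listValue, FreeSemigroup.letters]
  | ih2 a w ha hw =>
    rw [FreeSemigroup.letters_mul, listValue_append, ha, hw, eval_mul]
    rfl

theorem rank_listValue_le {l : List P.Gen} (hl : l ≠ []) : rank (P.listValue l) ≤ m := by
  obtain ⟨a, t, rfl⟩ := List.exists_cons_of_ne_nil hl
  rw [listValue, List.map_cons, List.prod_cons]
  exact (rank_mul_le_left _ _).trans (P.eval (FreeSemigroup.of a)).2

/-- A list of generators can be cut into two parts whose values satisfy `Good`. -/
def HasSplit (Good : FullTransformation n → FullTransformation n → Prop) (l : List P.Gen) : Prop :=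
  ∃ a b, a ++ b = l ∧ Good (P.listValue a) (P.listValue b)

variable {P} {Good : FullTransformation n → FullTransformation n → Prop}

/-- If a cut inside a factor of rank above `k` can always be moved to one of its ends, then
replacing a factor of rank above `k` by another one with the same value preserves `HasSplit`. -/
theorem HasSplit.replace
    (hGood : ∀ x u₁ u₂ y, rank u₁ ≤ m → rank u₂ ≤ m → k < rank (u₁ * u₂) →
      Good (x * u₁) (u₂ * y) → Good x (u₁ * u₂ * y) ∨ Good (x * u₁ * u₂) y)
    {x u v y : List P.Gen} (huv : P.listValue u = P.listValue v) (hu : k < rank (P.listValue u))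
    (h : P.HasSplit Good (x ++ (u ++ y))) : P.HasSplit Good (x ++ (v ++ y)) := by
  obtain ⟨a, b, hab, hG⟩ := h
  have left : Good (P.listValue x) (P.listValue u * P.listValue y) →
      P.HasSplit Good (x ++ (v ++ y)) := fun h =>
    ⟨x, v ++ y, rfl, by rwa [listValue_append, ← huv]⟩
  have right : Good (P.listValue x * P.listValue u) (P.listValue y) →
      P.HasSplit Good (x ++ (v ++ y)) := fun h =>
    ⟨x ++ v, y, List.append_assoc _ _ _, by rwa [listValue_append, ← huv]⟩
  rcases List.append_eq_append_iff.1 hab with ⟨c, rfl, rfl⟩ | ⟨c, rfl, hc⟩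
  · refine ⟨a, c ++ (v ++ y), (List.append_assoc _ _ _).symm, ?_⟩
    simpa only [listValue_append, huv] using hG
  rcases List.append_eq_append_iff.1 hc with ⟨d, rfl, rfl⟩ | ⟨d, rfl, rfl⟩
  · refine ⟨x ++ (v ++ d), b, by simp only [List.append_assoc], ?_⟩
    simpa only [listValue_append, huv] using hG
  simp only [listValue_append] at hG hu left right
  rcases eq_or_ne c [] with rfl | hc'
  · exact left (by simpa [listValue, mul_assoc] using hG)
  rcases eq_or_ne d [] with rfl | hd'
  · exact right (by simpa [listValue, mul_assoc] using hG)
  rcases hGood _ _ _ _ (P.rank_listValue_le hc') (P.rank_listValue_le hd') hu hG with h | h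
  · exact left h
  · exact right (by rwa [← mul_assoc])

theorem HasSplit.of_eval_eq
    (hGood : ∀ x u₁ u₂ y, rank u₁ ≤ m → rank u₂ ≤ m → k < rank (u₁ * u₂) →
      Good (x * u₁) (u₂ * y) → Good x (u₁ * u₂ * y) ∨ Good (x * u₁ * u₂) y)
    (hP : ∀ r ∈ P.rels, k < rank (P.eval r.1 : FullTransformation n))
    {u v : FreeSemigroup P.Gen} (huv : P.eval u = P.eval v) (h : P.HasSplit Good u.letters) :
    P.HasSplit Good v.letters := by
  -- the largest congruence whose classes respect `HasSplit`
  let R : FreeSemigroup P.Gen → FreeSemigroup P.Gen → Prop := fun u v => ∀ x y : List P.Gen,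
    P.HasSplit Good (x ++ (u.letters ++ y)) ↔ P.HasSplit Good (x ++ (v.letters ++ y))
  have hR : Equivalence R := ⟨fun _ _ _ => Iff.rfl, fun h x y => (h x y).symm,
    fun h h' x y => (h x y).trans (h' x y)⟩
  have hRmul : ∀ {u u' v v'}, R u u' → R v v' → R (u * v) (u' * v') := by
    intro u u' v v' hu hv x y
    have h1 := hu x (v.letters ++ y)
    have h2 := hv (x ++ u'.letters) y
    rw [List.append_assoc, List.append_assoc] at h2
    rw [FreeSemigroup.letters_mul, FreeSemigroup.letters_mul, List.append_assoc,
      List.append_assoc]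
    exact h1.trans h2
  let c : Con (FreeSemigroup P.Gen) := { r := R, iseqv := hR, mul' := hRmul }
  have hrels : ∀ u v, (u, v) ∈ P.rels → R u v := by
    intro u v hr x y
    have heq : P.listValue u.letters = P.listValue v.letters := by
      rw [listValue_letters, listValue_letters, (P.eval_eq_iff u v).2 (ConGen.Rel.of _ _ hr)]
    have hk : k < rank (P.listValue u.letters) := by
      rw [listValue_letters]
      exact hP (u, v) hr
    have hk' : k < rank (P.listValue v.letters) := by rwa [← heq]
    exact ⟨HasSplit.replace hGood heq hk, HasSplit.replace hGood heq.symm hk'⟩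
  have hle : conGen (fun u v => (u, v) ∈ P.rels) ≤ c := Con.conGen_le.2 hrels
  have huv' : R u v := hle ((P.eval_eq_iff u v).1 huv)
  simpa using (huv' [] []).1 (by simpa using h)

/-- Suppose that relations of rank above `k` preserve `HasSplit Good`, where `Good` forces the left
part to have the same kernel as `p`. If `p * q = p' * q'` with `Good p q` and the kernels of `p` and
`p'` are incomparable, then the relations of rank above `k` do not define the semigroup. -/
theorem not_forall_lt_rank
    (hGood : ∀ x u₁ u₂ y, rank u₁ ≤ m → rank u₂ ≤ m → k < rank (u₁ * u₂) →
      Good (x * u₁) (u₂ * y) → Good x (u₁ * u₂ * y) ∨ Good (x * u₁ * u₂) y)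
    {p q p' q' : FullTransformation n} (hp : rank p ≤ m) (hq : rank q ≤ m) (hp' : rank p' ≤ m)
    (hq' : rank q' ≤ m) (heq : p * q = p' * q') (hpq : Good p q)
    (hker : ∀ a b, Good a b →
      (act a).FactorsThrough (act p) ∧ (act p).FactorsThrough (act a))
    (hpp' : ¬ (act p).FactorsThrough (act p')) (hp'p : ¬ (act p').FactorsThrough (act p)) :
    ¬ ∀ r ∈ P.rels, k < rank (P.eval r.1 : FullTransformation n) := by
  intro hP
  obtain ⟨wp, hwp⟩ := P.eval_surjective ⟨p, hp⟩
  obtain ⟨wq, hwq⟩ := P.eval_surjective ⟨q, hq⟩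
  obtain ⟨wp', hwp'⟩ := P.eval_surjective ⟨p', hp'⟩
  obtain ⟨wq', hwq'⟩ := P.eval_surjective ⟨q', hq'⟩
  have heval : P.eval (wp * wq) = P.eval (wp' * wq') := by
    rw [eval_mul, eval_mul, hwp, hwq, hwp', hwq']
    exact Subtype.ext heq
  have hsplit : P.HasSplit Good (wp * wq).letters :=
    ⟨wp.letters, wq.letters, rfl, by simpa only [listValue_letters, hwp, hwq] using hpq⟩
  obtain ⟨a, b, hab, hG⟩ := hsplit.of_eval_eq hGood hP heval
  have hval : P.listValue wp'.letters = p' := by rw [listValue_letters, hwp']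
  obtain ⟨h1, h2⟩ := hker _ _ hG
  rw [FreeSemigroup.letters_mul] at hab
  -- either `a` is a prefix of the word for `p'`, or conversely
  rcases List.append_eq_append_iff.1 hab with ⟨c, hc, -⟩ | ⟨c, rfl, -⟩
  · rw [hc, listValue_append] at hval
    refine hp'p fun i j hij => ?_
    rw [← hval]
    exact factorsThrough_mul _ _ (h1 hij)
  · rw [listValue_append, hval] at h2
    exact hpp' fun i j hij => h2 (factorsThrough_mul _ _ hij)

end SemigroupPresentation

/-! ### Lower bounds for the relational depth -/

namespace FullTransformation

variable {n m k : ℕ}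

theorem le_relationalDepth_rankIdeal (hn : 0 < n) (hmn : m ≤ n)
    (h : ∀ P : SemigroupPresentation (rankIdeal n m),
      ¬ ∀ r ∈ P.rels, k < rank (P.eval r.1 : FullTransformation n)) :
    ((m + 1 - k : ℕ) : ℕ∞) ≤ relationalDepth (rankIdeal n m) := by
  refine le_iInf fun P => ?_
  obtain ⟨r, hr, hrk⟩ : ∃ r ∈ P.rels, rank (P.eval r.1 : FullTransformation n) ≤ k := by
    by_contra! hcon
    exact h P hcon
  refine le_trans ?_ (le_iSup₂_of_le r hr le_rfl)
  rw [SemigroupPresentation.wordDepth, elementDepth_eq hn hmn]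
  exact_mod_cast Nat.sub_le_sub_left hrk _

theorem rels_nonempty (hn : 0 < n) (hm : 0 < m) (P : SemigroupPresentation (rankIdeal n m)) :
    P.rels.Nonempty := by
  by_contra hempty
  -- a constant map is idempotent, while no word over an alphabet is
  obtain ⟨w, hw⟩ := P.eval_surjective ⟨cap n 1, (rank_cap one_pos hn).trans_le hm⟩
  have hidem : P.eval (w * w) = P.eval w := by
    rw [P.eval_mul, hw]
    exact Subtype.ext (ext_act fun i => Fin.ext (by simp [act_cap]))
  have hle : conGen (fun u v => (u, v) ∈ P.rels) ≤ (⊥ : Con (FreeSemigroup P.Gen)) :=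
    Con.conGen_le.2 fun u v h => (hempty ⟨_, h⟩).elim
  have : w * w = w := hle ((P.eval_eq_iff _ _).1 hidem)
  have hlen := congrArg FreeSemigroup.length this
  simp [FreeSemigroup.length] at hlen

/-- The transformation `i ↦ max (min i (k - 1)) (i - (n - r))`: it collapses the interval from
`k - 1` to `n - r + k - 1` and then increases by one in each step. -/
def midCollapse (n r k : ℕ) : FullTransformation n :=
  ofFun fun i => ⟨max (min i (k - 1)) (i - (n - r)), by lia⟩

theorem act_midCollapse (r : ℕ) (i : Fin n) :
    (act (midCollapse n r k) i : ℕ) = max (min (i : ℕ) (k - 1)) (i - (n - r)) := rfl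

theorem cap_mul_cap {r : ℕ} (hkr : k ≤ r) : cap n r * cap n k = cap n k :=
  ext_act fun i => Fin.ext (by simp only [act_mul, act_cap]; lia)

theorem midCollapse_mul_cap {r : ℕ} : midCollapse n r k * cap n k = cap n k :=
  ext_act fun i => Fin.ext (by simp only [act_mul, act_cap, act_midCollapse]; lia)

theorem rank_midCollapse_le {r : ℕ} (hkr : k < r) (hrn : r ≤ n) :
    rank (midCollapse n r k) ≤ r := by
  have h : rank (midCollapse n r k) ≤ rank (cap n r) := rank_le_of_range_subset <| by
    rw [range_cap (by lia)]
    rintro _ ⟨i, rfl⟩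
    rw [Set.mem_ofPred_eq, act_midCollapse]
    lia
  rwa [rank_cap (by lia) hrn] at h

theorem not_factorsThrough_midCollapse {r : ℕ} (hk : 0 < k) (hkr : k < r) (hrn : r < n) :
    ¬ (act (cap n r)).FactorsThrough (act (midCollapse n r k)) := fun h => by
  have := @h ⟨k - 1, by lia⟩ ⟨k, by lia⟩ (Fin.ext (by simp only [act_midCollapse]; lia))
  rw [Fin.ext_iff, act_cap, act_cap] at this
  simp only at this
  lia

theorem not_factorsThrough_cap {r : ℕ} (hk : 0 < k) (hkr : k < r) (hrn : r < n) :
    ¬ (act (midCollapse n r k)).FactorsThrough (act (cap n r)) := fun h => by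
  have := @h ⟨n - 2, by lia⟩ ⟨n - 1, by lia⟩ (Fin.ext (by simp only [act_cap]; lia))
  rw [Fin.ext_iff, act_midCollapse, act_midCollapse] at this
  simp only at this
  lia

/-- Relations of rank above `k` preserve cuts of words into two parts with fixed values `p` and `q`
of maximal rank `m` whose product has rank `k`. Such `p` and `q` exist because `n - m` points lie
outside the image of `p`, enough for `q` to take them to the `m - k` missing points of its image. -/
theorem le_relationalDepth_of_lt (hk : 0 < k) (hkm : k < m) (hmn : m < n) (hkmn : 2 * m ≤ n + k) :
    ((m + 1 - k : ℕ) : ℕ∞) ≤ relationalDepth (rankIdeal n m) := by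
  refine le_relationalDepth_rankIdeal (by lia) hmn.le fun P => ?_
  -- `q` agrees with `cap n k` on the image of `cap n m`, and takes the remaining points onto
  -- `k, …, m - 1`
  let q : FullTransformation n :=
    ofFun fun i =>
      ⟨if (i : ℕ) < m then min i (k - 1) else min (i - m + k) (m - 1), by split <;> lia⟩
  have hact : ∀ i, (act q i : ℕ) =
      if (i : ℕ) < m then min (i : ℕ) (k - 1) else min (i - m + k) (m - 1) := fun i => rfl
  have hq : rank q = m := by
    rw [← rank_cap (n := n) (by lia : 0 < m) hmn.le, rank_eq, rank_eq, range_cap (by lia)]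
    congr 1
    ext y
    rw [Set.mem_ofPred_eq]
    constructor
    · rintro ⟨i, rfl⟩
      rw [hact]
      split <;> lia
    · intro hy
      by_cases hyk : (y : ℕ) < k
      · exact ⟨y, Fin.ext (by rw [hact, if_pos hy]; lia)⟩
      · exact ⟨⟨y - k + m, by lia⟩, Fin.ext (by rw [hact, if_neg (by simp)]; simp only; lia)⟩
  have hcap : rank (cap n m) = m := rank_cap (by lia) hmn.le
  have hcapk : rank (cap n k) = k := rank_cap hk (by lia)
  have hpq : cap n m * q = cap n k := ext_act fun i => Fin.ext (by
    rw [act_mul, hact, act_cap, act_cap, if_pos (by lia)]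
    lia)
  refine P.not_forall_lt_rank (Good := fun a b => a = cap n m ∧ b = q) ?_ hcap.le hq.le
    (rank_midCollapse_le hkm hmn.le) (by lia) (hpq.trans midCollapse_mul_cap.symm) ⟨rfl, rfl⟩
    (fun a b h => by rw [h.1]; exact ⟨fun _ _ h => h, fun _ _ h => h⟩)
    (not_factorsThrough_midCollapse hk hkm hmn) (not_factorsThrough_cap hk hkm hmn)
  -- A cut inside a factor `u₁ * u₂` forces `im u₁` to be the image of `cap n m`, and the kernel of
  -- `u₂` to be that of `q`; so `u₁ * u₂` has rank at most `k`.
  rintro x u₁ u₂ y hu₁ hu₂ hlt ⟨h1, h2⟩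
  have hrange : Set.range (act (cap n m)) = Set.range (act u₁) := by
    refine Set.eq_of_subset_of_ncard_le (h1 ▸ range_mul_subset x u₁) ?_ (Set.toFinite _)
    rw [← rank_eq, ← rank_eq, hcap]
    exact hu₁
  have hker : (act u₂).FactorsThrough (act q) :=
    factorsThrough_of_ncard_le (h2 ▸ factorsThrough_mul u₂ y) (by
      rw [← rank_eq, ← rank_eq, hq]
      exact hu₂)
  have h3 : rank (u₁ * u₂) = rank (cap n m * u₂) := by
    rw [rank_eq, rank_eq, range_mul, range_mul, hrange]
  have h4 : rank (cap n m * u₂) ≤ rank (cap n m * q) :=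
    rank_le_of_factorsThrough fun i j hij => hker hij
  rw [hpq, hcapk] at h4
  lia

/-- In the full transformation monoid, relations of rank at least `n - 1` preserve the property of
having a prefix with a given kernel, if that kernel has `n - 1` classes. -/
theorem three_le_relationalDepth (hn : 3 ≤ n) :
    (3 : ℕ∞) ≤ relationalDepth (rankIdeal n n) := by
  suffices h : ((n + 1 - (n - 2) : ℕ) : ℕ∞) ≤ relationalDepth (rankIdeal n n) by
    rw [show n + 1 - (n - 2) = 3 by lia] at h
    exact h
  refine le_relationalDepth_rankIdeal (by lia) le_rfl fun P => ?_
  have hcap : rank (cap n (n - 1)) = n - 1 := rank_cap (by lia) (by lia)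
  refine P.not_forall_lt_rank
    (Good := fun a _ => (act a).FactorsThrough (act (cap n (n - 1))) ∧
      (act (cap n (n - 1))).FactorsThrough (act a))
    ?_ (p := cap n (n - 1)) (q := cap n (n - 2)) (p' := midCollapse n (n - 1) (n - 2))
    (q' := cap n (n - 2)) (rank_le _) (rank_le _) (rank_le _) (rank_le _)
    ((cap_mul_cap (by lia)).trans midCollapse_mul_cap.symm)
    ⟨fun _ _ h => h, fun _ _ h => h⟩ (fun a b h => h)
    (not_factorsThrough_midCollapse (by lia) (by lia) (by lia))
    (not_factorsThrough_cap (by lia) (by lia) (by lia))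
  rintro x u₁ u₂ y - - hlt ⟨h1, h2⟩
  have hxu₁ : rank (x * u₁) = n - 1 := by
    rw [← hcap]
    exact le_antisymm (rank_le_of_factorsThrough h1) (rank_le_of_factorsThrough h2)
  rcases (rank_le x).lt_or_eq with hx | hx
  · -- `x` has rank `n - 1` already, so its kernel is that of `x * u₁`
    have hker : (act (x * u₁)).FactorsThrough (act x) := factorsThrough_mul x u₁
    have hker' : (act x).FactorsThrough (act (x * u₁)) :=
      factorsThrough_of_ncard_le hker (by rw [← rank_eq, ← rank_eq]; lia)
    exact Or.inl ⟨fun i j h => hker' (h1 h), fun i j h => h2 (hker h)⟩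
  · -- `x` is a permutation, so `u₁` has rank `n - 1` and `u₁ * u₂` has the same kernel
    have hsurj : Set.range (act x) = Set.univ :=
      Set.eq_of_subset_of_ncard_le (Set.subset_univ _) (by
        rw [← rank_eq, hx]
        simp) (Set.toFinite _)
    have hu₁ : rank u₁ = n - 1 := by
      rw [← hxu₁, rank_eq, rank_eq, range_mul, hsurj, Set.image_univ]
    have hker : (act u₁).FactorsThrough (act (u₁ * u₂)) :=
      factorsThrough_of_ncard_le (factorsThrough_mul u₁ u₂) (by rw [← rank_eq, ← rank_eq]; lia)
    refine Or.inr ⟨fun i j h => factorsThrough_mul (x * u₁) u₂ (h1 h), fun i j h => h2 ?_⟩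
    exact hker h

end FullTransformation

open FullTransformation in
theorem mainTheorem4 (n m : ℕ) (hn : 3 ≤ n) (hm : 1 ≤ m) (hmn : m ≤ n) :
    (m = n → relationalDepth (rankIdeal n m) = 3) ∧
    (m < n → ((n : ℚ) + 1) / 2 < m → relationalDepth (rankIdeal n m) = ((n - m + 1 : ℕ) : ℕ∞)) ∧
    ((m : ℚ) ≤ ((n : ℚ) + 1) / 2 → relationalDepth (rankIdeal n m) = (m : ℕ∞)) := by
  refine ⟨?_, fun hlt h => ?_, fun h => ?_⟩
  · rintro rfl
    have h1 := relationalDepth_rankIdeal_le (n := m) (m := m) (r := m - 2) (by lia) le_rfl (by lia)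
      fun k _ _ => ⟨by lia, by lia, by lia⟩
    rw [show m + 1 - (m - 2) = 3 by lia] at h1
    exact le_antisymm h1 (three_le_relationalDepth hn)
  · have h' : n + 1 < 2 * m := by
      rw [div_lt_iff₀ two_pos] at h
      exact_mod_cast mul_comm (m : ℚ) 2 ▸ h
    have h1 := relationalDepth_rankIdeal_le (n := n) (m := m) (r := 2 * m - n) (by lia) hmn (by lia)
      fun k _ _ => ⟨by lia, by lia, by lia⟩
    have h2 := le_relationalDepth_of_lt (k := 2 * m - n) (by lia) (by lia) hlt (by lia)
    rw [show m + 1 - (2 * m - n) = n - m + 1 by lia] at h1 h2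
    exact le_antisymm h1 h2
  · have h' : 2 * m ≤ n + 1 := by
      rw [le_div_iff₀ two_pos] at h
      exact_mod_cast mul_comm (m : ℚ) 2 ▸ h
    have h1 := relationalDepth_rankIdeal_le (n := n) (m := m) (r := 1) hm hmn (by lia)
      fun k h h' => absurd h' (by lia)
    refine le_antisymm h1 ?_
    rcases hm.eq_or_lt with rfl | hm'
    · refine le_relationalDepth_rankIdeal (k := 1) (by lia) hmn fun P hP => ?_
      obtain ⟨r, hr⟩ := rels_nonempty (by lia) one_pos P
      exact absurd (P.eval r.1).2 (not_le.2 (hP r hr))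
    · exact le_relationalDepth_of_lt (k := 1) one_pos hm' (by lia) h'
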